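/- Let $p$ be a prime number and $e\ge 1$ an integer. Let $\mathcal C_{p,e}$ be the category whose objects are the complete discrete valuation rings $R$ of mixed characteristic $(0,p)$ with perfect residue field and absolute ramification index $e$ (that is, $p\in\mathfrak m^{e}\setminus\mathfrak m^{e+1}$, where $\mathfrak m$ is the maximal ideal of $R$), with all ring homomorphisms as morphisms. For $n\ge 1$ let $\mathcal R^{n}_{p,e}$ be the category whose objects are the principal Artinian local rings $\overline R$ of length $n$ with perfect residue field of characteristic $p$, subject, when $n>e$, to the additional condition $p\in\overline{\mathfrak m}^{e}\setminus\overline{\mathfrak m}^{e+1}$, where $\overline{\mathfrak m}$ is the maximal ideal of $\overline R$; morphisms are again all ring homomorphisms. For a local ring $(R,\mathfrak m)$, the ring $R/\mathfrak m^n$ is called its $n$-th residue ring. Let $\mathrm{Pr}_n:\mathcal C_{p,e}\to\mathcal R^n_{p,e}$ and, for $m\ge n$, $\mathrm{Pr}^m_n:\mathcal R^m_{p,e}\to\mathcal R^n_{p,e}$ be the functors taking a ring to its $n$-th residue ring. The category $\mathcal C_{p,e}$ is called $n$-liftable if there is a functor $L:\mathcal R^n_{p,e}\to\mathcal C_{p,e}$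 such that 1. $\mathrm{Pr}_n(L(\overline R))\cong\overline R$ for every object $\overline R$ of $\mathcal R^n_{p,e}$; 2. $\mathrm{Pr}_1\circ L$ is naturally isomorphic to $\mathrm{Pr}^n_1$; 3. $L\circ\mathrm{Pr}_n$ is naturally isomorphic to the identity functor of $\mathcal C_{p,e}$. The lifting number of $\mathcal C_{p,e}$ is the smallest integer $n\ge1$ such that $\mathcal C_{p,e}$ is $n$-liftable, and $\infty$ if there is no such $n$. **Theorem.** Let $p$ be a prime number and $e>1$ an integer. Then the lifting number of $\mathcal C_{p,e}$ is greater than $e$. Moreover, if $p\mid e$, then for every perfect field $k$ of characteristic $p$, with ring of Witt vectors $W(k)$, there are two totally ramified extensions $L_1,L_2$ of degree $e$ of the field $\operatorname{Frac}W(k)$ which are not isomorphic as fields, but whose valuation rings (the integral closures of $W(k)$ in $L_1$ and $L_2$) have $e$-th residue rings that are isomorphic as $W(k)$-algebras. -/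

import Mathlib

open CategoryTheory IsLocalRing

universe u

namespace LiftingNumber

/-- The `n`-th residue ring `R / 𝔪 ^ n` of a local ring `R`. -/
abbrev ResidueRing (R : Type u) [CommRing R] [IsLocalRing R] (n : ℕ) : Type u :=
  R ⧸ (maximalIdeal R ^ n)

theorem pow_le_comap {R S : Type u} [CommRing R] [CommRing S] [IsLocalRing R] [IsLocalRing S]
    (f : R →+* S) (hf : IsLocalHom f) (n : ℕ) :
    maximalIdeal R ^ n ≤ (maximalIdeal S ^ n).comap f := by
  rw [← Ideal.map_le_iff_le_comap, Ideal.map_pow]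
  exact Ideal.pow_right_mono (((local_hom_TFAE f).out 0 2).mp hf) n

/-- The ring homomorphism between `n`-th residue rings induced by a local homomorphism. -/
def residueRingMap {R S : Type u} [CommRing R] [CommRing S] [IsLocalRing R] [IsLocalRing S]
    (f : R →+* S) (hf : IsLocalHom f) (n : ℕ) : ResidueRing R n →+* ResidueRing S n :=
  Ideal.quotientMap (maximalIdeal S ^ n) f (pow_le_comap f hf n)

/-- `R` is a complete discrete valuation ring of mixed characteristic `(0, p)` with perfect
residue field and absolute ramification index `e` (that is, `p` has normalized valuation `e`). -/
structure IsCompleteDVR (p e : ℕ) (R : Type u) [CommRing R] : Prop where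
  [isDomain : IsDomain R]
  [isDVR : IsDiscreteValuationRing R]
  complete : IsAdicComplete (maximalIdeal R) R
  charZero : CharZero R
  charP : CharP (ResidueField R) p
  perfect : PerfectField (ResidueField R)
  mem : (p : R) ∈ maximalIdeal R ^ e
  not_mem : (p : R) ∉ maximalIdeal R ^ (e + 1)

/-- `R` is a principal Artinian local ring of length `n` with perfect residue field of
characteristic `p`; if `n > e` it is moreover required that `p ∈ 𝔪 ^ e ∖ 𝔪 ^ (e + 1)`. -/
structure IsPrincipalArtinian (p e n : ℕ) (R : Type u) [CommRing R] : Prop where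
  [isLocal : IsLocalRing R]
  [isArtinian : IsArtinianRing R]
  [isPrincipal : IsPrincipalIdealRing R]
  length_eq : Module.length R R = n
  charP : CharP (ResidueField R) p
  perfect : PerfectField (ResidueField R)
  mem : e < n → (p : R) ∈ maximalIdeal R ^ e
  not_mem : e < n → (p : R) ∉ maximalIdeal R ^ (e + 1)

/-- The category `𝒞_{p,e}`; the morphisms are all ring homomorphisms. -/
abbrev CatC (p e : ℕ) : Type (u + 1) :=
  ObjectProperty.FullSubcategory (fun R : CommRingCat.{u} => IsCompleteDVR p e R)

/-- The category `ℛ_{p,e}^n`; the morphisms are all ring homomorphisms. -/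
abbrev CatR (p e n : ℕ) : Type (u + 1) :=
  ObjectProperty.FullSubcategory (fun R : CommRingCat.{u} => IsPrincipalArtinian p e n R)

section Helpers

variable {R : Type u} [CommRing R] [IsLocalRing R]

theorem length_residueRing [IsPrincipalIdealRing R] (n : ℕ)
    (h : ∀ i < n, maximalIdeal R ^ (i + 1) ≠ maximalIdeal R ^ i) :
    Module.length R (ResidueRing R n) = n := by
  induction n with
  | zero =>
    have : Subsingleton (ResidueRing R 0) := by
      rw [Ideal.Quotient.subsingleton_iff, pow_zero, Ideal.one_eq_top]
    simp
  | succ n ih =>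
    obtain ⟨t, ht⟩ := (IsPrincipalIdealRing.principal (maximalIdeal R)).principal
    have ht : maximalIdeal R = Ideal.span {t} := ht
    have htn : ∀ k, maximalIdeal R ^ k = Ideal.span {t ^ k} := fun k => by
      rw [ht, Ideal.span_singleton_pow]
    have hle : maximalIdeal R ^ (n + 1) ≤ maximalIdeal R ^ n := Ideal.pow_le_pow_right (by omega)
    have hc : maximalIdeal R ≤
        Submodule.comap (LinearMap.mulLeft R (t ^ n)) (maximalIdeal R ^ (n + 1)) := by
      intro x hx
      rw [Submodule.mem_comap, LinearMap.mulLeft_apply, pow_succ]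
      exact Ideal.mul_mem_mul (by rw [htn]; exact Ideal.mem_span_singleton_self _) hx
    let f : (R ⧸ maximalIdeal R) →ₗ[R] ResidueRing R (n + 1) := Submodule.mapQ _ _ _ hc
    let g : ResidueRing R (n + 1) →ₗ[R] ResidueRing R n :=
      Submodule.factor hle
    have hg : Function.Surjective g := Submodule.factor_surjective hle
    have hf : Function.Injective f := by
      rw [← LinearMap.ker_eq_bot, LinearMap.ker_eq_bot']
      intro x
      obtain ⟨x, rfl⟩ := Submodule.Quotient.mk_surjective _ x
      intro hx
      rw [Submodule.mapQ_apply, Submodule.Quotient.mk_eq_zero, LinearMap.mulLeft_apply] at hx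
      rw [Submodule.Quotient.mk_eq_zero]
      by_contra hxm
      have hu : IsUnit x := by simpa using hxm
      refine h n (by omega) (le_antisymm hle ?_)
      rw [htn n, Ideal.span_singleton_le_iff_mem]
      rwa [Ideal.mul_unit_mem_iff_mem _ hu] at hx
    have hex : Function.Exact f g := by
      intro y
      obtain ⟨y, rfl⟩ := Submodule.Quotient.mk_surjective _ y
      have hgy : g (Submodule.Quotient.mk y) = Submodule.Quotient.mk y := rfl
      rw [hgy, Submodule.Quotient.mk_eq_zero, htn n, Ideal.mem_span_singleton]
      constructor
      · rintro ⟨c, rfl⟩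
        exact ⟨Submodule.Quotient.mk c, rfl⟩
      · rintro ⟨x, hx⟩
        obtain ⟨x, rfl⟩ := Submodule.Quotient.mk_surjective _ x
        rw [Submodule.mapQ_apply, Submodule.Quotient.eq, LinearMap.mulLeft_apply] at hx
        have hx := hle hx
        rw [htn n, Ideal.mem_span_singleton] at hx
        exact (dvd_sub_right (dvd_mul_right _ _)).mp hx
    have h1 : Module.length R (R ⧸ maximalIdeal R) = 1 := by
      rw [Module.length_eq_one_iff, isSimpleModule_iff_isCoatom]
      exact (maximalIdeal.isMaximal R).out
    rw [Module.length_eq_add_of_exact f g hf hg hex, h1, ih (fun i hi => h i (by omega))]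
    push_cast
    ring

theorem pow_ne_of_length [IsArtinianRing R] [IsPrincipalIdealRing R] {n : ℕ}
    (hn : Module.length R R = n) (i : ℕ) (hi : i < n) :
    maximalIdeal R ^ (i + 1) ≠ maximalIdeal R ^ i := by
  classical
  intro hcon
  have hex : ∃ i, maximalIdeal R ^ (i + 1) = maximalIdeal R ^ i := ⟨i, hcon⟩
  have hl := length_residueRing (R := R) (Nat.find hex) (fun j hj => Nat.find_min hex hj)
  have hle : Nat.find hex ≤ i := Nat.find_min' hex hcon
  have hs := Nat.find_spec hex
  have hbot : maximalIdeal R ^ Nat.find hex = ⊥ := by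
    refine Submodule.eq_bot_of_le_smul_of_le_jacobson_bot (maximalIdeal R) _
      (IsNoetherian.noetherian _) ?_ (IsLocalRing.maximalIdeal_le_jacobson _)
    rw [smul_eq_mul, ← pow_succ', hs]
  rw [LinearEquiv.length_eq (Submodule.quotEquivOfEqBot _ hbot), hn] at hl
  have : n = Nat.find hex := by exact_mod_cast hl
  omega

theorem nontrivial_residueRing {n : ℕ} (hn : 0 < n) : Nontrivial (ResidueRing R n) := by
  refine Ideal.Quotient.nontrivial_iff.mpr fun h => ?_
  have := Ideal.pow_le_self (I := maximalIdeal R) hn.ne'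
  rw [h, top_le_iff] at this
  exact (maximalIdeal.isMaximal R).ne_top this

theorem isPrincipalArtinian_residueRing [IsPrincipalIdealRing R] {p e n : ℕ} (hn : 0 < n)
    (h : ∀ i < n, maximalIdeal R ^ (i + 1) ≠ maximalIdeal R ^ i)
    (hc : CharP (ResidueField R) p) (hp : PerfectField (ResidueField R))
    (hmem : e < n → (p : R) ∈ maximalIdeal R ^ e)
    (hnot : e < n → (p : R) ∉ maximalIdeal R ^ (e + 1)) :
    IsPrincipalArtinian p e n (ResidueRing R n) := by
  have := nontrivial_residueRing (R := R) hn
  have hs : Function.Surjective (Ideal.Quotient.mk (maximalIdeal R ^ n)) :=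
    Ideal.Quotient.mk_surjective
  have hloc : IsLocalRing (ResidueRing R n) := IsLocalRing.of_surjective' _ hs
  have hlh : IsLocalHom (Ideal.Quotient.mk (maximalIdeal R ^ n)) := by
    constructor
    intro a ha
    by_contra hna
    have hpow : a ^ n ∈ maximalIdeal R ^ n := Ideal.pow_mem_pow ((mem_maximalIdeal a).mpr hna) n
    have := ha.pow n
    rw [← map_pow, Ideal.Quotient.eq_zero_iff_mem.mpr hpow] at this
    exact not_isUnit_zero this
  have hmax : maximalIdeal (ResidueRing R n) =
      (maximalIdeal R).map (Ideal.Quotient.mk (maximalIdeal R ^ n)) := by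
    have h04 := ((local_hom_TFAE (Ideal.Quotient.mk (maximalIdeal R ^ n))).out 0 4).mp hlh
    conv_rhs => arg 2; rw [← h04]
    exact (Ideal.map_comap_of_surjective _ hs _).symm
  have hcm : ∀ k ≤ n, ∀ x : R, Ideal.Quotient.mk (maximalIdeal R ^ n) x ∈
      maximalIdeal (ResidueRing R n) ^ k ↔ x ∈ maximalIdeal R ^ k := by
    intro k hk x
    rw [hmax, ← Ideal.map_pow, ← Ideal.mem_comap, Ideal.comap_map_of_surjective _ hs,
      ← RingHom.ker_eq_comap_bot, Ideal.mk_ker, sup_eq_left.mpr (Ideal.pow_le_pow_right hk)]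
  have hlen : Module.length (ResidueRing R n) (ResidueRing R n) = n := by
    rw [← length_residueRing n h]
    exact (Module.length_eq_of_surjective (M := ResidueRing R n) (R := ResidueRing R n)
      (S := R) hs).symm
  have hfl : IsFiniteLength (ResidueRing R n) (ResidueRing R n) := by
    rw [← Module.length_ne_top_iff, hlen]; exact ENat.natCast_ne_top n
  have hart : IsArtinianRing (ResidueRing R n) :=
    (isFiniteLength_iff_isNoetherian_isArtinian.mp hfl).2
  have hpir : IsPrincipalIdealRing (ResidueRing R n) := IsPrincipalIdealRing.of_surjective _ hs
  have hbij : Function.Bijective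
      (ResidueField.map (Ideal.Quotient.mk (maximalIdeal R ^ n))) := by
    refine ⟨RingHom.injective _, fun y => ?_⟩
    obtain ⟨y, rfl⟩ := residue_surjective y
    obtain ⟨y, rfl⟩ := hs y
    exact ⟨residue R y, ResidueField.map_residue _ _⟩
  let E := RingEquiv.ofBijective _ hbij
  exact
    { length_eq := hlen
      charP := charP_of_injective_ringHom (f := E.toRingHom) E.injective p
      perfect := PerfectField.of_ringEquiv E
      mem := fun h => by
        rw [← map_natCast (Ideal.Quotient.mk (maximalIdeal R ^ n)), hcm e h.le]; exact hmem h
      not_mem := fun h => by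
        rw [← map_natCast (Ideal.Quotient.mk (maximalIdeal R ^ n)), hcm (e + 1) h]
        exact hnot h }

theorem isLocalHom_of_isCompleteDVR {p e : ℕ} {R S : Type u} [CommRing R] [CommRing S]
    (hR : IsCompleteDVR p e R) (hS : IsCompleteDVR p e S) (f : R →+* S) : IsLocalHom f := by
  have := hR.isDomain
  have := hR.isDVR
  have := hS.isDomain
  have := hS.isDVR
  have := hS.charP
  have hpS : (p : S) ∈ maximalIdeal S := by
    rw [← residue_eq_zero_iff, map_natCast, CharP.cast_eq_zero]
  obtain ⟨t, ht⟩ := (IsPrincipalIdealRing.principal (maximalIdeal R)).principal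
  have ht : maximalIdeal R = Ideal.span {t} := ht
  have htn : ∀ k, maximalIdeal R ^ k = Ideal.span {t ^ k} := fun k => by
    rw [ht, Ideal.span_singleton_pow]
  have h1 := hR.mem
  have h2 := hR.not_mem
  rw [htn e, Ideal.mem_span_singleton] at h1
  obtain ⟨c, hc⟩ := h1
  have hu : IsUnit c := by
    by_contra hcm
    refine h2 ?_
    rw [hc, pow_succ]
    exact Ideal.mul_mem_mul (by rw [htn]; exact Ideal.mem_span_singleton_self _)
      ((mem_maximalIdeal c).mpr hcm)
  constructor
  intro a ha
  by_contra hna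
  have hae : a ^ e ∈ maximalIdeal R ^ e := Ideal.pow_mem_pow ((mem_maximalIdeal a).mpr hna) e
  have hdvd : (p : R) ∣ a ^ e := by
    rw [htn e, Ideal.mem_span_singleton] at hae
    rw [hc]
    exact hu.mul_right_dvd.mpr hae
  have h3 : (p : S) ∣ f a ^ e := by simpa using map_dvd f hdvd
  exact (mem_maximalIdeal _).mp hpS (isUnit_of_dvd_unit h3 (ha.pow e))

theorem isLocalHom_of_isPrincipalArtinian {p e n : ℕ} {R S : Type u} [CommRing R] [CommRing S]
    (hR : IsPrincipalArtinian p e n R) (hS : IsPrincipalArtinian p e n S) (f : R →+* S) :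
    IsLocalHom f := by
  have := hR.isLocal
  have := hR.isArtinian
  have := hS.isLocal
  constructor
  intro a ha
  by_contra hna
  have hnil : IsNilpotent a := by
    have h := IsArtinianRing.isNilpotent_jacobson_bot (R := R)
    rw [IsLocalRing.jacobson_eq_maximalIdeal ⊥ bot_ne_top] at h
    obtain ⟨k, hk⟩ := h
    refine ⟨k, ?_⟩
    have := Ideal.pow_mem_pow ((mem_maximalIdeal a).mpr hna) k
    rwa [hk] at this
  exact (hnil.map f).not_isUnit ha

end Helpers

instance (p e : ℕ) (X : CatC.{u} p e) : IsDomain X.obj := X.property.isDomain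
instance (p e : ℕ) (X : CatC.{u} p e) : IsDiscreteValuationRing X.obj := X.property.isDVR
instance (p e n : ℕ) (X : CatR.{u} p e n) : IsLocalRing X.obj := X.property.isLocal

theorem isLocalHom_C {p e : ℕ} {X Y : CatC.{u} p e} (f : X ⟶ Y) : IsLocalHom f.hom.hom :=
  isLocalHom_of_isCompleteDVR X.property Y.property _

theorem isLocalHom_R {p e n : ℕ} {X Y : CatR.{u} p e n} (f : X ⟶ Y) : IsLocalHom f.hom.hom :=
  isLocalHom_of_isPrincipalArtinian X.property Y.property _

theorem residueRing_C {p e n : ℕ} (hn : 0 < n) (X : CatC.{u} p e) :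
    IsPrincipalArtinian p e n (ResidueRing X.obj n) := by
  refine isPrincipalArtinian_residueRing hn (fun i _ => ?_) X.property.charP X.property.perfect
    (fun _ => X.property.mem) (fun _ => X.property.not_mem)
  exact ((Ideal.pow_right_strictAnti _ (IsDiscreteValuationRing.not_a_field X.obj)
    (maximalIdeal.isMaximal X.obj).ne_top) i.lt_succ_self).ne

theorem residueRing_R {p e m n : ℕ} (hn : 0 < n) (hnm : n ≤ m) (X : CatR.{u} p e m) :
    IsPrincipalArtinian p e n (ResidueRing X.obj n) := by
  have := X.property.isArtinian
  have := X.property.isPrincipal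
  exact isPrincipalArtinian_residueRing hn
    (fun i hi => pow_ne_of_length X.property.length_eq i (by omega))
    X.property.charP X.property.perfect
    (fun h => X.property.mem (by omega)) (fun h => X.property.not_mem (by omega))

/-- The canonical projection functor `Pr_n : 𝒞_{p,e} ⥤ ℛ_{p,e}^n`, `R ↦ R / 𝔪 ^ n`. -/
def Pr (p e n : ℕ) (hn : 0 < n) : CatC.{u} p e ⥤ CatR.{u} p e n where
  obj X := ⟨CommRingCat.of (ResidueRing X.obj n), residueRing_C hn X⟩
  map f := ObjectProperty.homMk
    (CommRingCat.ofHom (residueRingMap f.hom.hom (isLocalHom_C f) n))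
  map_id X := by
    ext x
    rfl
  map_comp f g := by
    ext x
    rfl

/-- The canonical projection functor `Pr^m_n : ℛ_{p,e}^m ⥤ ℛ_{p,e}^n`, `R ↦ R / 𝔪 ^ n`,
for `0 < n ≤ m`. -/
def PrR (p e m n : ℕ) (hn : 0 < n) (hnm : n ≤ m) : CatR.{u} p e m ⥤ CatR.{u} p e n where
  obj X := ⟨CommRingCat.of (ResidueRing X.obj n), residueRing_R hn hnm X⟩
  map f := ObjectProperty.homMk
    (CommRingCat.ofHom (residueRingMap f.hom.hom (isLocalHom_R f) n))
  map_id X := by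
    ext x
    rfl
  map_comp f g := by
    ext x
    rfl

/-- `L` is an `n`-th lifting functor of `𝒞_{p,e}`. -/
structure IsLiftingFunctor (p e n : ℕ) (hn : 0 < n) (L : CatR.{u} p e n ⥤ CatC.{u} p e) :
    Prop where
  obj_iso : ∀ X : CatR.{u} p e n, Nonempty ((Pr p e n hn).obj (L.obj X) ≅ X)
  residue_iso : Nonempty (L ⋙ Pr p e 1 one_pos ≅ PrR p e n 1 one_pos hn)
  iso_id : Nonempty (Pr p e n hn ⋙ L ≅ 𝟭 (CatC.{u} p e))

/-- `𝒞_{p,e}` is `n`-liftable. -/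
def IsLiftable (p e n : ℕ) (hn : 0 < n) : Prop :=
  ∃ L : CatR.{u} p e n ⥤ CatC.{u} p e, IsLiftingFunctor p e n hn L

/-- The lifting number of `𝒞_{p,e}`: the least positive integer `n` such that `𝒞_{p,e}` is
`n`-liftable, and `∞` if there is no such `n` (the infimum of the empty set in `ℕ∞` is `⊤`). -/
noncomputable def liftingNumber (p e : ℕ) : ℕ∞ :=
  sInf {N : ℕ∞ | ∃ (n : ℕ) (hn : 0 < n), IsLiftable.{u} p e n hn ∧ N = n}

/-- A totally ramified extension of degree `e` of the fraction field of a discrete valuation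
ring `A`: a field extension of degree `e` in which the integral closure of `A` is a discrete
valuation ring of ramification index `e` over `A`. -/
structure TotallyRamifiedExtension (A : Type u) [CommRing A] [IsDomain A]
    [IsDiscreteValuationRing A] (e : ℕ) where
  /-- the extension field -/
  L : Type u
  [field : Field L]
  [algebraBase : Algebra A L]
  [algebraFrac : Algebra (FractionRing A) L]
  [tower : IsScalarTower A (FractionRing A) L]
  [finite : FiniteDimensional (FractionRing A) L]
  finrank_eq : Module.finrank (FractionRing A) L = e
  [isDVR : IsDiscreteValuationRing (integralClosure A L)]
  map_maximalIdeal : (maximalIdeal A).map (algebraMap A (integralClosure A L)) =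
    maximalIdeal (integralClosure A L) ^ e

attribute [instance] TotallyRamifiedExtension.field TotallyRamifiedExtension.algebraBase
  TotallyRamifiedExtension.algebraFrac TotallyRamifiedExtension.tower
  TotallyRamifiedExtension.finite TotallyRamifiedExtension.isDVR

/-- The valuation ring of a totally ramified extension. -/
abbrev TotallyRamifiedExtension.integers {A : Type u} [CommRing A] [IsDomain A]
    [IsDiscreteValuationRing A] {e : ℕ} (E : TotallyRamifiedExtension A e) :=
  integralClosure A E.L

end LiftingNumber

/-! Let `A` be a discrete valuation ring with uniformizer `ϖ`, and adjoin a root `π` of the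
Eisenstein polynomial `X ^ e - ϖ g`. The result is a totally ramified discrete valuation ring with
`𝔪 ^ e = (ϖ)`, so its `e`-th residue ring is `A[X] / (ϖ, X ^ e)`, whatever `g` is
(`residueRingEquiv`). The ring itself does remember `g`: an `x` with `x ^ e = ϖ` would divide `π`,
and `v = π / x` would satisfy `v ^ e = g(π)` (`exists_pow_eq_aeval`).

Take `A = W(k)`, `ϖ = p`, and compare `g = 1`, where `p` has an `e`-th root, with a `g` for which
`g(π)` is not an `e`-th power. For `n ≤ e` a lifting functor would turn the isomorphism of `n`-th
residue rings into a ring homomorphism from the first ring to the second. It fixes the integer `p`,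
so it would produce a forbidden `e`-th root (`not_isLiftable`). An isomorphism of fraction fields
fails for the same reason, such a root being integral (`isEmpty_ringEquiv`).

If `p ∤ e`, let `g` be a constant whose residue is not an `e`-th power in a suitable finite field.
If `p ∣ e`, let `g = 1 - X` over any perfect `k`: modulo `π ^ 2` every `p`-th power is congruent to
an element of `A`, and `1 - π` is not (`not_exists_root_one_sub_X`). -/

namespace LiftingNumber

open Polynomial

/-! ### Eisenstein extensions of a discrete valuation ring -/

section RamifiedPolynomial

variable {A : Type u} [CommRing A]

/-- The polynomial `X ^ e - ϖ g`. -/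
noncomputable def ramifiedPoly (ϖ : A) (e : ℕ) (g : A[X]) : A[X] := X ^ e - C ϖ * g

/-- The conditions under which `X ^ e - ϖ g` is an Eisenstein polynomial at the prime `ϖ`
of a discrete valuation ring. -/
structure IsRamifiedDatum (ϖ : A) (e : ℕ) (g : A[X]) : Prop where
  irreducible : Irreducible ϖ
  one_lt : 1 < e
  degree_lt : g.degree < e
  isUnit : IsUnit (g.coeff 0)

/-- The extension ring of `A` generated by a root of `X ^ e - ϖ g`. -/
abbrev RamifiedRing (ϖ : A) (e : ℕ) (g : A[X]) : Type u := AdjoinRoot (ramifiedPoly ϖ e g)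

/-- The root of `X ^ e - ϖ g`, a uniformizer. -/
noncomputable abbrev unif (ϖ : A) (e : ℕ) (g : A[X]) : RamifiedRing ϖ e g :=
  AdjoinRoot.root (ramifiedPoly ϖ e g)

theorem unif_pow (ϖ : A) (e : ℕ) (g : A[X]) :
    unif ϖ e g ^ e = algebraMap A _ ϖ * aeval (unif ϖ e g) g := by
  have h : aeval (unif ϖ e g) (ramifiedPoly ϖ e g) = 0 := by
    rw [AdjoinRoot.aeval_eq, AdjoinRoot.mk_self]
  simp only [ramifiedPoly, map_sub, map_pow, aeval_X, map_mul, aeval_C] at h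
  exact sub_eq_zero.mp h

namespace IsRamifiedDatum

variable {ϖ : A} {e : ℕ} {g : A[X]}

theorem pos (h : IsRamifiedDatum ϖ e g) : 0 < e := lt_trans one_pos h.one_lt

theorem degree_C_mul_lt (h : IsRamifiedDatum ϖ e g) : (C ϖ * g).degree < e :=
  (by
  rw [← smul_eq_C_mul]
  exact (degree_smul_le ϖ g).trans_lt h.degree_lt)

theorem monic (h : IsRamifiedDatum ϖ e g) : (ramifiedPoly ϖ e g).Monic := monic_X_pow_sub h.degree_C_mul_lt

theorem finite (h : IsRamifiedDatum ϖ e g) : Module.Finite A (RamifiedRing ϖ e g) := h.monic.finite_adjoinRoot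

theorem free (h : IsRamifiedDatum ϖ e g) : Module.Free A (RamifiedRing ϖ e g) := h.monic.free_adjoinRoot

theorem isIntegral (h : IsRamifiedDatum ϖ e g) : Algebra.IsIntegral A (RamifiedRing ϖ e g) :=
  have := h.finite
  inferInstance

theorem natDegree (h : IsRamifiedDatum ϖ e g) [Nontrivial A] : (ramifiedPoly ϖ e g).natDegree = e := by
  refine natDegree_eq_of_degree_eq_some ?_
  rw [ramifiedPoly, degree_sub_eq_left_of_degree_lt (by rw [degree_X_pow]; exact h.degree_C_mul_lt),
    degree_X_pow]

theorem coeff_zero (h : IsRamifiedDatum ϖ e g) : (ramifiedPoly ϖ e g).coeff 0 = -(ϖ * g.coeff 0) := by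
  simp [ramifiedPoly, coeff_X_pow, h.pos.ne]

theorem finrank_eq (h : IsRamifiedDatum ϖ e g) [Nontrivial A] : Module.finrank A (RamifiedRing ϖ e g) = e := by
  rw [(AdjoinRoot.powerBasis' h.monic).finrank, AdjoinRoot.powerBasis'_dim, h.natDegree]

theorem sub_mem_span_unif (q : A[X]) :
    aeval (unif ϖ e g) q - algebraMap A _ (q.coeff 0) ∈ Ideal.span {unif ϖ e g} := by
  obtain ⟨r, hr⟩ := X_dvd_sub_C (p := q)
  rw [Ideal.mem_span_singleton]
  refine ⟨aeval (unif ϖ e g) r, ?_⟩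
  simpa using congrArg (aeval (unif ϖ e g)) hr

/-- Modulo the root, `π ^ e = ϖ g(π)` reads `0 = ϖ g(0)`, and `g(0)` is a unit. -/
theorem algebraMap_mem_span_unif (h : IsRamifiedDatum ϖ e g) : algebraMap A (RamifiedRing ϖ e g) ϖ ∈
    Ideal.span {unif ϖ e g} := by
  have h1 := Ideal.mul_mem_left (Ideal.span {unif ϖ e g}) (algebraMap A _ ϖ)
    (sub_mem_span_unif (ϖ := ϖ) (e := e) (g := g) g)
  rw [mul_sub, ← unif_pow] at h1
  have h2 : unif ϖ e g ^ e ∈ Ideal.span {unif ϖ e g} :=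
    Ideal.pow_mem_of_mem _ (Ideal.mem_span_singleton_self _) _ h.pos
  have h3 := (Submodule.sub_mem_iff_right _ h2).mp h1
  rwa [Ideal.mul_unit_mem_iff_mem _ (h.isUnit.map _)] at h3

variable [IsDomain A] [IsDiscreteValuationRing A]

theorem isEisensteinAt (h : IsRamifiedDatum ϖ e g) : (ramifiedPoly ϖ e g).IsEisensteinAt (Ideal.span {ϖ}) where
  leading := by
    rw [h.monic.leadingCoeff, Ideal.mem_span_singleton]
    exact fun h1 => h.irreducible.not_isUnit (isUnit_of_dvd_one h1)
  mem {n} hn := by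
    rw [h.natDegree] at hn
    simp [ramifiedPoly, coeff_X_pow, hn.ne, Ideal.mem_span_singleton]
  notMem := by
    rw [h.coeff_zero, Ideal.span_singleton_pow, Ideal.mem_span_singleton, dvd_neg,
      h.isUnit.dvd_mul_right]
    intro h1
    rw [pow_two] at h1
    exact h.irreducible.not_isUnit (isUnit_of_dvd_one
      ((mul_dvd_mul_iff_left h.irreducible.ne_zero).mp (by rwa [mul_one])))

theorem irreducible_poly (h : IsRamifiedDatum ϖ e g) : Irreducible (ramifiedPoly ϖ e g) := by
  refine h.isEisensteinAt.irreducible ?_ h.monic.isPrimitive (by rw [h.natDegree]; exact h.pos)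
  rw [Ideal.span_singleton_prime h.irreducible.ne_zero]
  exact h.irreducible.prime

theorem isDomain (h : IsRamifiedDatum ϖ e g) : IsDomain (RamifiedRing ϖ e g) :=
  AdjoinRoot.isDomain_of_prime h.irreducible_poly.prime

theorem algebraMap_injective (h : IsRamifiedDatum ϖ e g) : Function.Injective (algebraMap A (RamifiedRing ϖ e g)) := by
  refine AdjoinRoot.of.injective_of_degree_ne_zero ?_
  rw [degree_eq_natDegree h.monic.ne_zero, h.natDegree]
  exact_mod_cast h.pos.ne'

/-- The reduction of the ring generated by a root of `X ^ e - ϖ g` to the residue field of `A`. -/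
noncomputable def reduction (h : IsRamifiedDatum ϖ e g) : RamifiedRing ϖ e g →+* ResidueField A :=
  AdjoinRoot.lift (residue A) 0 (by
    rw [eval₂_at_zero, h.coeff_zero, map_neg, map_mul, (residue_eq_zero_iff ϖ).mpr
      ((mem_maximalIdeal ϖ).mpr h.irreducible.not_isUnit), zero_mul, neg_zero])

theorem reduction_algebraMap (h : IsRamifiedDatum ϖ e g) (a : A) : h.reduction (algebraMap A _ a) = residue A a :=
  AdjoinRoot.lift_of _

theorem reduction_surjective (h : IsRamifiedDatum ϖ e g) : Function.Surjective h.reduction := fun y => by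
  obtain ⟨a, rfl⟩ := residue_surjective y
  exact ⟨_, h.reduction_algebraMap a⟩

theorem ker_reduction (h : IsRamifiedDatum ϖ e g) : RingHom.ker h.reduction = Ideal.span {unif ϖ e g} := by
  have hr : h.reduction (unif ϖ e g) = 0 := AdjoinRoot.lift_root _
  apply le_antisymm
  · intro x hx
    obtain ⟨q, rfl⟩ := AdjoinRoot.mk_surjective x
    rw [← AdjoinRoot.aeval_eq] at hx ⊢
    have h1 := sub_mem_span_unif (ϖ := ϖ) (e := e) (g := g) q
    refine (Submodule.sub_mem_iff_left _ ?_).mp h1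
    have h2 : h.reduction (aeval (unif ϖ e g) q - algebraMap A _ (q.coeff 0)) = 0 := by
      obtain ⟨y, hy⟩ := Ideal.mem_span_singleton.mp h1
      rw [hy, map_mul, hr, zero_mul]
    rw [map_sub, RingHom.mem_ker.mp hx, zero_sub, neg_eq_zero, reduction_algebraMap,
      residue_eq_zero_iff, h.irreducible.maximalIdeal_eq, Ideal.mem_span_singleton] at h2
    exact Ideal.mem_of_dvd _ (map_dvd _ h2) h.algebraMap_mem_span_unif
  · rw [Ideal.span_singleton_le_iff_mem]
    exact hr

theorem isMaximal_span_unif (h : IsRamifiedDatum ϖ e g) : (Ideal.span {unif ϖ e g}).IsMaximal := by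
  rw [← h.ker_reduction]
  exact RingHom.ker_isMaximal_of_surjective _ h.reduction_surjective

/-- By integrality a maximal ideal lies over that of `A`. It therefore contains `ϖ`, hence `π ^ e`,
hence `π`. -/
theorem eq_span_unif (h : IsRamifiedDatum ϖ e g) (M : Ideal (RamifiedRing ϖ e g)) (hM : M.IsMaximal) :
    M = Ideal.span {unif ϖ e g} := by
  have := h.isIntegral
  have h1 := eq_maximalIdeal (Ideal.isMaximal_comap_of_isIntegral_of_isMaximal (R := A) M)
  have h2 : algebraMap A _ ϖ ∈ M := by
    rw [← Ideal.mem_comap, h1]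
    exact (mem_maximalIdeal ϖ).mpr h.irreducible.not_isUnit
  have h3 : unif ϖ e g ^ e ∈ M := by
    rw [unif_pow]
    exact Ideal.mul_mem_right _ _ h2
  refine (h.isMaximal_span_unif.eq_of_le hM.ne_top ?_).symm
  rw [Ideal.span_singleton_le_iff_mem]
  exact hM.isPrime.mem_of_pow_mem _ h3

theorem isLocalRing (h : IsRamifiedDatum ϖ e g) : IsLocalRing (RamifiedRing ϖ e g) :=
  .of_unique_max_ideal ⟨_, h.isMaximal_span_unif, h.eq_span_unif⟩

theorem unif_ne_zero (h : IsRamifiedDatum ϖ e g) : unif ϖ e g ≠ 0 := by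
  have := h.isDomain
  intro h0
  have h1 := h.algebraMap_mem_span_unif
  rw [h0, Ideal.span_singleton_zero, Ideal.mem_bot] at h1
  exact h.irreducible.ne_zero (h.algebraMap_injective (h1.trans (map_zero _).symm))

theorem isDiscreteValuationRing (h : IsRamifiedDatum ϖ e g) :
    haveI := h.isDomain; IsDiscreteValuationRing (RamifiedRing ϖ e g) := by
  have := h.isDomain
  have := h.isLocalRing
  have hm : maximalIdeal (RamifiedRing ϖ e g) = Ideal.span {unif ϖ e g} :=
    h.eq_span_unif _ (maximalIdeal.isMaximal _)
  have hf : ¬IsField (RamifiedRing ϖ e g) := by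
    rw [isField_iff_maximalIdeal_eq, hm, Ideal.span_singleton_eq_bot]
    exact h.unif_ne_zero
  refine ((IsDiscreteValuationRing.TFAE _ hf).out 4 0).mp ?_
  exact hm ▸ ⟨_, rfl⟩

section Local

variable [IsLocalRing (RamifiedRing ϖ e g)]

theorem maximalIdeal_eq (h : IsRamifiedDatum ϖ e g) : maximalIdeal (RamifiedRing ϖ e g) = Ideal.span {unif ϖ e g} :=
  h.eq_span_unif _ (maximalIdeal.isMaximal _)

theorem isUnit_aeval (h : IsRamifiedDatum ϖ e g) : IsUnit (aeval (unif ϖ e g) g) := by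
  have h1 := sub_mem_span_unif (ϖ := ϖ) (e := e) (g := g) g
  rw [← h.maximalIdeal_eq] at h1
  by_contra h2
  exact (mem_maximalIdeal _).mp ((Submodule.sub_mem_iff_right _ ((mem_maximalIdeal _).mpr h2)).mp h1)
    (h.isUnit.map _)

/-- Since `g(π)` is a unit, `π ^ e` and `ϖ` are associated. -/
theorem maximalIdeal_pow_eq (h : IsRamifiedDatum ϖ e g) : maximalIdeal (RamifiedRing ϖ e g) ^ e =
    Ideal.span {algebraMap A _ ϖ} := by
  rw [h.maximalIdeal_eq, Ideal.span_singleton_pow, unif_pow,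
    Ideal.span_singleton_mul_right_unit h.isUnit_aeval]

theorem map_maximalIdeal (h : IsRamifiedDatum ϖ e g) : (maximalIdeal A).map (algebraMap A (RamifiedRing ϖ e g)) =
    maximalIdeal (RamifiedRing ϖ e g) ^ e := by
  rw [h.maximalIdeal_pow_eq, h.irreducible.maximalIdeal_eq, Ideal.map_span, Set.image_singleton]

/-- The residue field does not change. -/
noncomputable def residueFieldEquiv (h : IsRamifiedDatum ϖ e g) : ResidueField (RamifiedRing ϖ e g) ≃+* ResidueField A :=
  (Ideal.quotEquivOfEq (h.maximalIdeal_eq.trans h.ker_reduction.symm)).trans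
    (RingHom.quotientKerEquivOfSurjective h.reduction_surjective)

end Local

/-- If the extension contains an `e`-th root of `ϖ` then the value of `g` is an `e`-th power. -/
theorem exists_pow_eq_aeval (h : IsRamifiedDatum ϖ e g) (x : RamifiedRing ϖ e g) (hx : x ^ e = algebraMap A _ ϖ) :
    ∃ v : RamifiedRing ϖ e g, v ^ e = aeval (unif ϖ e g) g := by
  have := h.isDomain
  have := h.isDiscreteValuationRing
  -- `x ^ e = ϖ` divides `π ^ e`, and divisibility of `e`-th powers descends in an integrally closed
  -- domain.
  have h1 : x ∣ unif ϖ e g := by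
    rw [← IsIntegrallyClosed.pow_dvd_pow_iff h.pos.ne', hx, unif_pow]
    exact dvd_mul_right _ _
  obtain ⟨v, hv⟩ := h1
  refine ⟨v, mul_left_cancel₀ (a := x ^ e) (fun h0 => ?_) ?_⟩
  · exact h.irreducible.ne_zero (h.algebraMap_injective ((hx.symm.trans h0).trans (map_zero _).symm))
  · rw [← mul_pow, ← hv, unif_pow, hx]

end IsRamifiedDatum
end RamifiedPolynomial

/-! ### Transport of maximal ideals and adic completeness -/

theorem map_maximalIdeal_of_equiv {S T : Type*} [CommRing S] [CommRing T] [IsLocalRing S]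
    [IsLocalRing T] (E : S ≃+* T) : (maximalIdeal S).map (E : S →+* T) = maximalIdeal T :=
  eq_maximalIdeal (Ideal.map_isMaximal_of_equiv E)

/-- A ring `R` which is finite free over an `(a)`-adically complete ring `A` is `J`-adically
complete for every ideal `J` with a power equal to `aR`. -/
theorem isAdicComplete_of_pow_eq_span {A R : Type*} [CommRing A] [CommRing R] [Algebra A R]
    [Module.Finite A R] [Module.Free A R] (a : A) [IsAdicComplete (Ideal.span {a}) A]
    (J : Ideal R) (e : ℕ) (he : 0 < e) (hJ : J ^ e = Ideal.span {algebraMap A R a}) :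
    IsAdicComplete J R := by
  let b := Module.Free.chooseBasis A R
  have hpow : ∀ n, J ^ (e * n) = Ideal.span {algebraMap A R (a ^ n)} := fun n => by
    rw [pow_mul, hJ, Ideal.span_singleton_pow, map_pow]
  -- Along exponents divisible by `e`, the `J`-adic filtration is the `(a)`-adic one, coordinate by
  -- coordinate in a basis.
  have hcoord : ∀ n (x : R), x ∈ J ^ (e * n) ↔ ∀ i, b.repr x i ∈ Ideal.span {a} ^ n := by
    intro n x
    rw [hpow, Ideal.span_singleton_pow, Ideal.mem_span_singleton]
    simp only [Ideal.mem_span_singleton]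
    constructor
    · rintro ⟨y, rfl⟩ i
      rw [← Algebra.smul_def, map_smul, Finsupp.smul_apply, smul_eq_mul]
      exact dvd_mul_right _ _
    · intro h
      choose c hc using h
      refine ⟨∑ i, c i • b i, ?_⟩
      rw [← Algebra.smul_def, Finset.smul_sum]
      refine (b.sum_repr x).symm.trans (Finset.sum_congr rfl fun i _ => ?_)
      rw [hc, mul_smul]
  have hle : ∀ n, J ^ (e * n) ≤ J ^ n := fun n =>
    Ideal.pow_le_pow_right (Nat.le_mul_of_pos_left n he)
  refine { haus' := fun x hx => ?_, prec' := fun f hf => ?_ }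
  · simp only [SModEq.sub_mem, smul_eq_mul, Ideal.mul_top, sub_zero] at hx
    refine b.repr.map_eq_zero_iff.mp (Finsupp.ext fun i => ?_)
    refine IsHausdorff.haus (I := Ideal.span {a}) inferInstance _ fun n => ?_
    rw [SModEq.sub_mem, smul_eq_mul, Ideal.mul_top, sub_zero]
    exact (hcoord n x).mp (hx _) i
  · simp only [SModEq.sub_mem, smul_eq_mul, Ideal.mul_top] at hf ⊢
    -- The coordinates of the subsequence `f (e * n)` are `(a)`-adically Cauchy.
    have hlim : ∀ i, ∃ l : A, ∀ n, b.repr (f (e * n)) i - l ∈ Ideal.span {a} ^ n := fun i => by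
      obtain ⟨l, hl⟩ := IsPrecomplete.prec (I := Ideal.span {a}) (M := A) inferInstance
        (f := fun n => b.repr (f (e * n)) i) (fun {m n} hmn => by
          rw [SModEq.sub_mem, smul_eq_mul, Ideal.mul_top, ← Finsupp.sub_apply, ← map_sub]
          exact (hcoord m _).mp (hf (Nat.mul_le_mul_left e hmn)) i)
      refine ⟨l, fun n => ?_⟩
      simpa only [SModEq.sub_mem, smul_eq_mul, Ideal.mul_top] using hl n
    choose l hl using hlim
    refine ⟨∑ i, l i • b i, fun n => ?_⟩
    have h1 := hf (Nat.le_mul_of_pos_left n he)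
    have h2 : f (e * n) - ∑ i, l i • b i ∈ J ^ (e * n) := by
      rw [hcoord]
      intro i
      rw [map_sub, Finsupp.sub_apply, b.repr_sum_self]
      exact hl i n
    simpa using Ideal.add_mem _ h1 (hle n h2)

/-! ### Residue rings of length at most `e`, and fraction fields -/

namespace IsRamifiedDatum

variable {A : Type u} [CommRing A] [IsDomain A] [IsDiscreteValuationRing A] {ϖ : A} {e : ℕ}
  {g g₁ g₂ : A[X]} {n : ℕ}

/-- The map from the ring of one datum to the `n`-th residue ring of another one
sending root to root. -/
noncomputable def toResidueRing [IsLocalRing (RamifiedRing ϖ e g₂)]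
    (h₂ : IsRamifiedDatum ϖ e g₂) (hn : n ≤ e) :
    RamifiedRing ϖ e g₁ →ₐ[A] ResidueRing (RamifiedRing ϖ e g₂) n :=
  AdjoinRoot.liftAlgHom _ (Algebra.ofId _ _) (Ideal.Quotient.mk _ (unif ϖ e g₂)) (by
    -- As `n ≤ e`, both `ϖ` and `π ^ e` vanish in the target, so the relation defining the source
    -- holds there for every `g₁`.
    have h0 : algebraMap A (ResidueRing (RamifiedRing ϖ e g₂) n) ϖ = 0 := by
      rw [IsScalarTower.algebraMap_apply A (RamifiedRing ϖ e g₂), Ideal.Quotient.algebraMap_eq,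
        Ideal.Quotient.eq_zero_iff_mem]
      refine Ideal.pow_le_pow_right hn ?_
      rw [h₂.maximalIdeal_pow_eq]
      exact Ideal.mem_span_singleton_self _
    have h1 : Ideal.Quotient.mk (maximalIdeal (RamifiedRing ϖ e g₂) ^ n) (unif ϖ e g₂) ^ e = 0 := by
      rw [← map_pow, Ideal.Quotient.eq_zero_iff_mem]
      refine Ideal.pow_le_pow_right hn (Ideal.pow_mem_pow ?_ e)
      rw [h₂.maximalIdeal_eq]
      exact Ideal.mem_span_singleton_self _
    change aeval _ (ramifiedPoly ϖ e g₁) = 0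
    simp only [ramifiedPoly, map_sub, map_pow, aeval_X, map_mul, aeval_C, h0, h1, zero_mul,
      sub_zero])

theorem toResidueRing_unif [IsLocalRing (RamifiedRing ϖ e g₂)] (h₂ : IsRamifiedDatum ϖ e g₂) (hn : n ≤ e) :
    h₂.toResidueRing hn (unif ϖ e g₁) = Ideal.Quotient.mk _ (unif ϖ e g₂) :=
  AdjoinRoot.liftAlgHom_root ..

/-- The map between `n`-th residue rings of two data sending root to root. -/
noncomputable def residueRingHom [IsLocalRing (RamifiedRing ϖ e g₁)]
    [IsLocalRing (RamifiedRing ϖ e g₂)]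
    (h₁ : IsRamifiedDatum ϖ e g₁) (h₂ : IsRamifiedDatum ϖ e g₂) (hn : n ≤ e) :
    ResidueRing (RamifiedRing ϖ e g₁) n →ₐ[A] ResidueRing (RamifiedRing ϖ e g₂) n :=
  Ideal.Quotient.liftₐ _ (h₂.toResidueRing hn) (by
    intro a ha
    rw [h₁.maximalIdeal_eq, Ideal.span_singleton_pow, Ideal.mem_span_singleton] at ha
    obtain ⟨y, rfl⟩ := ha
    rw [map_mul, map_pow, toResidueRing_unif, ← map_pow, Ideal.Quotient.eq_zero_iff_mem.mpr,
      zero_mul]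
    rw [h₂.maximalIdeal_eq]
    exact Ideal.pow_mem_pow (Ideal.mem_span_singleton_self _) n)

theorem residueRingHom_comp [IsLocalRing (RamifiedRing ϖ e g₁)]
    [IsLocalRing (RamifiedRing ϖ e g₂)]
    (h₁ : IsRamifiedDatum ϖ e g₁) (h₂ : IsRamifiedDatum ϖ e g₂) (hn : n ≤ e) :
    (residueRingHom h₂ h₁ hn).comp (residueRingHom h₁ h₂ hn) = AlgHom.id A _ := by
  refine Ideal.Quotient.algHom_ext A (AdjoinRoot.algHom_ext ?_)
  change residueRingHom h₂ h₁ hn (h₂.toResidueRing hn (unif ϖ e g₁)) = _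
  rw [toResidueRing_unif]
  change h₁.toResidueRing hn (unif ϖ e g₂) = _
  rw [toResidueRing_unif]
  rfl

/-- The `n`-th residue ring, `n ≤ e`, does not depend on the datum. -/
noncomputable def residueRingEquiv [IsLocalRing (RamifiedRing ϖ e g₁)]
    [IsLocalRing (RamifiedRing ϖ e g₂)]
    (h₁ : IsRamifiedDatum ϖ e g₁) (h₂ : IsRamifiedDatum ϖ e g₂) (hn : n ≤ e) :
    ResidueRing (RamifiedRing ϖ e g₁) n ≃ₐ[A] ResidueRing (RamifiedRing ϖ e g₂) n :=
  AlgEquiv.ofAlgHom (residueRingHom h₁ h₂ hn) (residueRingHom h₂ h₁ hn)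
    (residueRingHom_comp h₂ h₁ hn) (residueRingHom_comp h₁ h₂ hn)

theorem faithfulSMul (h : IsRamifiedDatum ϖ e g) :
    FaithfulSMul A (FractionRing (RamifiedRing ϖ e g)) := by
  have := h.isDomain
  rw [faithfulSMul_iff_algebraMap_injective,
    IsScalarTower.algebraMap_eq A (RamifiedRing ϖ e g)]
  exact (IsFractionRing.injective (RamifiedRing ϖ e g) _).comp h.algebraMap_injective

/-- The ring of a datum is the integral closure in its fraction field. -/
noncomputable def integersEquiv [IsDomain (RamifiedRing ϖ e g)]
    [IsDiscreteValuationRing (RamifiedRing ϖ e g)] (h : IsRamifiedDatum ϖ e g) :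
    RamifiedRing ϖ e g ≃ₐ[A] integralClosure A (FractionRing (RamifiedRing ϖ e g)) :=
  have := h.isIntegral
  IsIntegralClosure.equiv A _ (FractionRing (RamifiedRing ϖ e g)) _

/-- The totally ramified extension generated by a root of `X ^ e - ϖ g`. -/
noncomputable def extension (h : IsRamifiedDatum ϖ e g) : TotallyRamifiedExtension A e :=
  haveI := h.isDomain
  haveI := h.isDiscreteValuationRing
  haveI := h.faithfulSMul
  haveI := h.finite
  haveI := h.isIntegral
  letI : Algebra (FractionRing A) (FractionRing (RamifiedRing ϖ e g)) :=
    FractionRing.liftAlgebra A _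
  haveI : IsDiscreteValuationRing (integralClosure A (FractionRing (RamifiedRing ϖ e g))) :=
    IsDiscreteValuationRing.RingEquivClass.isDiscreteValuationRing h.integersEquiv
  haveI : FaithfulSMul A (RamifiedRing ϖ e g) :=
    (faithfulSMul_iff_algebraMap_injective _ _).mpr h.algebraMap_injective
  { L := FractionRing (RamifiedRing ϖ e g)
    tower := FractionRing.isScalarTower_liftAlgebra A _
    finite := .of_isLocalization A (RamifiedRing ϖ e g) (nonZeroDivisors A)
    finrank_eq := by
      rw [IsFractionRing.finrank_eq A (FractionRing A) (RamifiedRing ϖ e g)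
        (FractionRing (RamifiedRing ϖ e g)), h.finrank_eq]
    map_maximalIdeal := by
      rw [← map_maximalIdeal_of_equiv h.integersEquiv.toRingEquiv, ← Ideal.map_pow,
        ← h.map_maximalIdeal, Ideal.map_map]
      congr 1
      ext1 a
      exact (h.integersEquiv.commutes a).symm }

/-- The residue rings of the valuation ring of the extension. -/
noncomputable def integersResidueEquiv [IsLocalRing (RamifiedRing ϖ e g)]
    (h : IsRamifiedDatum ϖ e g) (n : ℕ) :
    ResidueRing (RamifiedRing ϖ e g) n ≃ₐ[A] ResidueRing h.extension.integers n :=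
  haveI := h.isDomain
  haveI := h.isDiscreteValuationRing
  let E : RamifiedRing ϖ e g ≃ₐ[A] h.extension.integers := h.integersEquiv
  Ideal.quotientEquivAlg _ _ E (by
    rw [← map_maximalIdeal_of_equiv E.toRingEquiv, ← Ideal.map_pow]
    rfl)

end IsRamifiedDatum

/-! ### Choices of `g` with and without an `e`-th root of `ϖ` -/

namespace IsRamifiedDatum

variable {A : Type u} [CommRing A] {ϖ : A} {e : ℕ}

theorem one (hϖ : Irreducible ϖ) (he : 1 < e) : IsRamifiedDatum ϖ e 1 where
  irreducible := hϖ
  one_lt := he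
  degree_lt := degree_one_le.trans_lt (by exact_mod_cast zero_lt_one.trans he)
  isUnit := by simp

theorem const (hϖ : Irreducible ϖ) (he : 1 < e) {a : A} (ha : IsUnit a) :
    IsRamifiedDatum ϖ e (C a) where
  irreducible := hϖ
  one_lt := he
  degree_lt := degree_C_le.trans_lt (by exact_mod_cast zero_lt_one.trans he)
  isUnit := by simpa using ha

theorem one_sub_X (hϖ : Irreducible ϖ) (he : 1 < e) : IsRamifiedDatum ϖ e (1 - X) where
  irreducible := hϖ
  one_lt := he
  degree_lt := by
    refine (degree_sub_le _ _).trans_lt (max_lt ?_ ?_)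
    · exact degree_one_le.trans_lt (by exact_mod_cast zero_lt_one.trans he)
    · exact degree_X_le.trans_lt (by exact_mod_cast he)
  isUnit := by simp

theorem unif_one_pow : unif ϖ e 1 ^ e = algebraMap A _ ϖ := by
  rw [unif_pow, map_one, mul_one]

variable [IsDomain A] [IsDiscreteValuationRing A]

theorem not_exists_root_const (hϖ : Irreducible ϖ) (he : 1 < e) {a : A} (ha : IsUnit a)
    (hr : ∀ y : ResidueField A, y ^ e ≠ residue A a) (x : RamifiedRing ϖ e (C a)) :
    x ^ e ≠ algebraMap A _ ϖ := by
  intro hx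
  have h := const hϖ he ha
  obtain ⟨v, hv⟩ := h.exists_pow_eq_aeval x hx
  refine hr (h.reduction v) ?_
  rw [← map_pow, hv, aeval_C, h.reduction_algebraMap]

/-- Otherwise `1 - t` is a `p`-th power, hence congruent to some `c ^ p` with `c ∈ A` modulo `t ^
2`. Then `1 - c ^ p` has valuation exactly `1`, but valuations of nonzero elements of `A` are
multiples of `e ≥ 2`. -/
theorem not_exists_root_one_sub_X {p : ℕ} [Fact p.Prime] (hp : Irreducible (p : A))
    (he : 1 < e) (hpe : p ∣ e) (x : RamifiedRing (p : A) e (1 - X)) :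
    x ^ e ≠ algebraMap A _ (p : A) := by
  intro hx
  have h := one_sub_X hp he
  have := h.isDomain
  have := h.isDiscreteValuationRing
  obtain ⟨v, hv⟩ := h.exists_pow_eq_aeval x hx
  set t := unif (p : A) e (1 - X) with ht
  obtain ⟨d, rfl⟩ := hpe
  replace hv : (v ^ d) ^ p = 1 - t := by
    rw [← pow_mul, mul_comm d p, hv, map_sub, map_one, aeval_X]
  have htu : ¬IsUnit t := by
    rw [← mem_nonunits_iff, ← mem_maximalIdeal, h.maximalIdeal_eq]
    exact Ideal.mem_span_singleton_self _
  have ht2p : t ^ 2 ∣ algebraMap A _ (p : A) := by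
    refine (pow_dvd_pow t (Nat.succ_le_of_lt he)).trans ?_
    rw [ht, unif_pow]
    exact (h.isUnit_aeval.mul_right_dvd).mpr dvd_rfl
  -- Write `v ^ d = t * y + c` with `c ∈ A`. In its `p`-th power the mixed terms carry a factor `p`,
  -- which `t ^ 2` divides.
  obtain ⟨q, hq⟩ := AdjoinRoot.mk_surjective (v ^ d)
  rw [← AdjoinRoot.aeval_eq] at hq
  obtain ⟨y, hy⟩ := Ideal.mem_span_singleton.mp
    (sub_mem_span_unif (ϖ := (p : A)) (e := p * d) (g := 1 - X) q)
  rw [hq, ← ht, sub_eq_iff_eq_add] at hy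
  set c := q.coeff 0
  obtain ⟨r, hr⟩ := exists_add_pow_prime_eq (Fact.out : p.Prime) (t * y) (algebraMap A _ c)
  rw [← hy, hv, ← map_natCast (algebraMap A (RamifiedRing (p : A) (p * d) (1 - X)))] at hr
  have h1 : t ^ 2 ∣ algebraMap A _ (1 - c ^ p) - t := by
    have h2 : algebraMap A _ (1 - c ^ p) - t =
        (t * y) ^ p + algebraMap A _ (p : A) * (t * y * algebraMap A _ c * r) := by
      rw [map_sub, map_one, map_pow]
      linear_combination hr
    rw [h2]
    refine dvd_add ?_ (ht2p.mul_right _)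
    rw [mul_pow]
    exact (pow_dvd_pow t (Fact.out : p.Prime).two_le).mul_right _
  have h3 : ¬IsUnit (1 - c ^ p) := fun hu => htu <| by
    refine isUnit_of_dvd_unit ?_ (hu.map (algebraMap A (RamifiedRing (p : A) (p * d) (1 - X))))
    exact (dvd_sub_left dvd_rfl).mp ((dvd_pow_self t two_ne_zero).trans h1)
  have h4 : (p : A) ∣ 1 - c ^ p := by
    rwa [← mem_nonunits_iff, ← mem_maximalIdeal, hp.maximalIdeal_eq,
      Ideal.mem_span_singleton] at h3
  have h5 : t ^ 2 ∣ t := (dvd_sub_right (ht2p.trans (map_dvd _ h4))).mp h1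
  refine htu (isUnit_of_dvd_one ((mul_dvd_mul_iff_left h.unif_ne_zero).mp ?_))
  rwa [mul_one, ← pow_two]

end IsRamifiedDatum

/-! ### Extensions of Witt vectors and the obstruction to lifting -/

section Witt

theorem charZero_wittVector {p : ℕ} [Fact p.Prime] {k : Type u} [Field k] [CharP k p] : CharZero (WittVector p k) := by
  obtain ⟨q, hq⟩ := CharP.exists (WittVector p k)
  rcases CharP.char_is_prime_or_zero (WittVector p k) q with hqp | rfl
  · have h1 : (q : k) = 0 := by
      rw [← map_natCast (WittVector.constantCoeff (p := p) (R := k)), CharP.cast_eq_zero, map_zero]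
    have h2 : p = q := (Nat.prime_dvd_prime_iff_eq Fact.out hqp).mp
      ((CharP.cast_eq_zero_iff k p q).mp h1)
    refine absurd ?_ (WittVector.irreducible (k := k) p).ne_zero
    subst h2
    exact CharP.cast_eq_zero _ _
  · exact CharP.charP_to_charZero _

variable {p : ℕ} [Fact p.Prime] {k : Type u} [Field k] [CharP k p] [PerfectRing k p]

theorem maximalIdeal_wittVector :
    maximalIdeal (WittVector p k) = RingHom.ker (WittVector.constantCoeff (p := p) (R := k)) := by
  rw [WittVector.ker_constantCoeff, (WittVector.irreducible p).maximalIdeal_eq]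

/-- The residue field of the ring of Witt vectors of `k` is `k`. -/
noncomputable def wittResidueFieldEquiv : ResidueField (WittVector p k) ≃+* k :=
  (Ideal.quotEquivOfEq maximalIdeal_wittVector).trans
    (RingHom.quotientKerEquivOfSurjective (WittVector.constantCoeff_surjective p))

theorem wittResidueFieldEquiv_residue (a : WittVector p k) :
    wittResidueFieldEquiv (residue _ a) = WittVector.constantCoeff a := rfl

variable {e : ℕ} {g : (WittVector p k)[X]}

theorem IsRamifiedDatum.isCompleteDVR (h : IsRamifiedDatum (p : WittVector p k) e g) :
    IsCompleteDVR p e (RamifiedRing (p : WittVector p k) e g) := by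
  have := h.isDomain
  have := h.isDiscreteValuationRing
  have := h.finite
  have := h.free
  have := charZero_wittVector (p := p) (k := k)
  have hchar : CharZero (RamifiedRing (p : WittVector p k) e g) :=
    charZero_of_injective_algebraMap h.algebraMap_injective
  let E : ResidueField (RamifiedRing (p : WittVector p k) e g) ≃+* k :=
    h.residueFieldEquiv.trans wittResidueFieldEquiv
  have hmem : (p : RamifiedRing (p : WittVector p k) e g) ∈ maximalIdeal _ ^ e := by
    rw [h.maximalIdeal_pow_eq, map_natCast]
    exact Ideal.mem_span_singleton_self _
  have : PerfectField k := PerfectRing.toPerfectField k p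
  exact
    { complete := isAdicComplete_of_pow_eq_span (p : WittVector p k) _ e h.pos h.maximalIdeal_pow_eq
      charZero := hchar
      charP := charP_of_injective_ringHom (f := E.symm.toRingHom) E.symm.injective p
      perfect := PerfectField.of_ringEquiv E.symm
      mem := hmem
      not_mem := fun hn => by
        -- Because `p` generates `𝔪 ^ e`, having `p ∈ 𝔪 ^ (e + 1)` would stop the strict descent of
        -- the powers of `𝔪`.
        refine (Ideal.pow_right_strictAnti _
          (IsDiscreteValuationRing.not_a_field (RamifiedRing (p : WittVector p k) e g))
          (maximalIdeal.isMaximal _).ne_top e.lt_succ_self).not_ge ?_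
        change maximalIdeal _ ^ e ≤ maximalIdeal _ ^ (e + 1)
        rw [h.maximalIdeal_pow_eq, Ideal.span_singleton_le_iff_mem, map_natCast]
        exact hn }

/-- The object of `𝒞_{p,e}` generated by a root of `X ^ e - p g`. -/
noncomputable def IsRamifiedDatum.obj (h : IsRamifiedDatum (p : WittVector p k) e g) :
    CatC.{u} p e :=
  ⟨CommRingCat.of (RamifiedRing (p : WittVector p k) e g), h.isCompleteDVR⟩

/-- Only the isomorphism of `L ∘ Pr_n` with the identity is needed. The lifted map need not be
`W(k)`-linear, since every ring homomorphism fixes `p`. -/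
theorem not_isLiftable (h : IsRamifiedDatum (p : WittVector p k) e g)
    (hg : ∀ x : RamifiedRing (p : WittVector p k) e g, x ^ e ≠ algebraMap _ _ (p : WittVector p k))
    {n : ℕ} (hn : 0 < n) (hne : n ≤ e) : ¬IsLiftable.{u} p e n hn := by
  rintro ⟨L, hL⟩
  obtain ⟨η⟩ := hL.iso_id
  have h₁ := IsRamifiedDatum.one h.irreducible h.one_lt
  have := h.isLocalRing
  have := h₁.isLocalRing
  let i : (Pr p e n hn).obj h₁.obj ≅ (Pr p e n hn).obj h.obj :=
    (ObjectProperty.fullyFaithfulι _).preimageIso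
      (IsRamifiedDatum.residueRingEquiv h₁ h hne).toRingEquiv.toCommRingCatIso
  let j : h₁.obj ⟶ h.obj := η.inv.app h₁.obj ≫ L.map i.hom ≫ η.hom.app h.obj
  let f : RamifiedRing (p : WittVector p k) e 1 →+* RamifiedRing (p : WittVector p k) e g :=
    j.hom.hom
  refine hg (f (unif _ _ _)) ?_
  rw [← map_pow, IsRamifiedDatum.unif_one_pow, map_natCast, map_natCast, map_natCast]

theorem isEmpty_ringEquiv (h : IsRamifiedDatum (p : WittVector p k) e g)
    (h₁ : IsRamifiedDatum (p : WittVector p k) e 1)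
    (hg : ∀ x : RamifiedRing (p : WittVector p k) e g,
      x ^ e ≠ algebraMap _ _ (p : WittVector p k)) :
    IsEmpty (h₁.extension.L ≃+* h.extension.L) := by
  refine ⟨fun φ => ?_⟩
  have := h.isDomain
  have := h₁.isDomain
  have := h.isDiscreteValuationRing
  let R₁ := RamifiedRing (p : WittVector p k) e 1
  let R := RamifiedRing (p : WittVector p k) e g
  let ψ : FractionRing R₁ ≃+* FractionRing R := φ
  have hψ : ψ (algebraMap R₁ _ (unif _ _ _)) ^ e = algebraMap R _ (p : R) := by
    rw [← map_pow, ← map_pow, IsRamifiedDatum.unif_one_pow, map_natCast, map_natCast, map_natCast,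
      map_natCast]
  -- The image of the root has an integral `e`-th power, so it already lies in the integrally closed
  -- ring `R`.
  obtain ⟨y, hy⟩ := IsIntegrallyClosed.exists_algebraMap_eq_of_isIntegral_pow (R := R) h.pos
    (hψ ▸ isIntegral_algebraMap)
  refine hg y (IsFractionRing.injective R (FractionRing R) ?_)
  rw [map_pow, hy, hψ, map_natCast, map_natCast, map_natCast]

end Witt

/-! ### Choice of the residue field -/

/-- For `e > 1` prime to `p` there is a finite field of characteristic `p` with an element which
is not an `e`-th power. -/
theorem exists_galoisField_not_pow (p e : ℕ) [Fact p.Prime] (he : 1 < e) (hpe : ¬p ∣ e) :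
    ∃ (n : ℕ) (a : GaloisField p n), ∀ y : GaloisField p n, y ^ e ≠ a := by
  obtain ⟨q, hq, hqe⟩ := Nat.exists_prime_and_dvd he.ne'
  have : Fact q.Prime := ⟨hq⟩
  have hqp : p.Coprime q := (Nat.coprime_primes Fact.out hq).mpr fun h => hpe (h ▸ hqe)
  -- By Fermat, `q` divides `p ^ (q - 1) - 1`, so the field with `p ^ (q - 1)` elements has a unit
  -- of order `q`. The `e`-th power map kills it, hence is not injective, and on a finite set not
  -- surjective either.
  have hn : q - 1 ≠ 0 := (Nat.sub_pos_of_lt hq.one_lt).ne'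
  refine ⟨q - 1, ?_⟩
  by_contra! hsurj
  have : Fintype (GaloisField p (q - 1)) := Fintype.ofFinite _
  have : DecidableEq (GaloisField p (q - 1)) := Classical.decEq _
  have hcard : q ∣ Fintype.card (GaloisField p (q - 1))ˣ := by
    rw [Fintype.card_units, ← Nat.card_eq_fintype_card, GaloisField.card p _ hn,
      ← Nat.modEq_iff_dvd' (Nat.one_le_pow _ _ (Fact.out : p.Prime).pos), ← Nat.totient_prime hq]
    exact (Nat.ModEq.pow_totient hqp).symm
  obtain ⟨x, hx⟩ := exists_prime_orderOf_dvd_card q hcard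
  have hinj : Function.Injective fun y : GaloisField p (q - 1) => y ^ e :=
    Finite.injective_iff_surjective.mpr hsurj
  have hx1 : x = 1 := by
    refine Units.ext (hinj ?_)
    have : x ^ e = 1 := orderOf_dvd_iff_pow_eq_one.mp (hx.symm ▸ hqe)
    simpa using congrArg Units.val this
  rw [hx1, orderOf_one] at hx
  exact hq.one_lt.ne hx

theorem exists_tame_datum (p e : ℕ) [Fact p.Prime] (he : 1 < e) (hpe : ¬p ∣ e) :
    ∃ (k : Type u) (_ : Field k) (_ : CharP k p) (_ : PerfectRing k p) (g : (WittVector p k)[X]),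
      IsRamifiedDatum (p : WittVector p k) e g ∧ ∀ x : RamifiedRing (p : WittVector p k) e g,
        x ^ e ≠ algebraMap _ _ (p : WittVector p k) := by
  obtain ⟨n, a, ha⟩ := exists_galoisField_not_pow p e he hpe
  let k : Type u := ULift.{u} (GaloisField p n)
  have hchar : CharP k p := charP_of_injective_ringHom
    (f := (ULift.ringEquiv (R := GaloisField p n)).symm.toRingHom) (RingEquiv.injective _) p
  have hfin : Finite k := inferInstance
  have hperf : PerfectRing k p := inferInstance
  obtain ⟨b, hb⟩ := WittVector.constantCoeff_surjective p (R := k) (ULift.up a)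
  have hr : ∀ y : ResidueField (WittVector p k), y ^ e ≠ residue _ b := fun y hy => by
    have h1 := congrArg wittResidueFieldEquiv hy
    rw [map_pow, wittResidueFieldEquiv_residue, hb] at h1
    exact ha _ (congrArg ULift.down h1)
  -- The residue of `b` is nonzero because `0` is an `e`-th power.
  have hbu : IsUnit b := by
    rw [← residue_ne_zero_iff_isUnit]
    intro h0
    exact hr 0 (by rw [h0, zero_pow (zero_lt_one.trans he).ne'])
  exact ⟨k, inferInstance, hchar, hperf, C b, .const (WittVector.irreducible p) he hbu,
    IsRamifiedDatum.not_exists_root_const (WittVector.irreducible p) he hbu hr⟩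

theorem exists_datum (p e : ℕ) [Fact p.Prime] (he : 1 < e) :
    ∃ (k : Type u) (_ : Field k) (_ : CharP k p) (_ : PerfectRing k p) (g : (WittVector p k)[X]),
      IsRamifiedDatum (p : WittVector p k) e g ∧ ∀ x : RamifiedRing (p : WittVector p k) e g,
        x ^ e ≠ algebraMap _ _ (p : WittVector p k) := by
  by_cases hpe : p ∣ e
  · let k : Type u := ULift.{u} (ZMod p)
    have hchar : CharP k p := charP_of_injective_ringHom
      (f := (ULift.ringEquiv (R := ZMod p)).symm.toRingHom) (RingEquiv.injective _) p
    have hfin : Finite k := inferInstance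
    have hperf : PerfectRing k p := inferInstance
    exact ⟨k, inferInstance, hchar, hperf, 1 - X, .one_sub_X (WittVector.irreducible p) he,
      IsRamifiedDatum.not_exists_root_one_sub_X (WittVector.irreducible p) he hpe⟩
  · exact exists_tame_datum p e he hpe

end LiftingNumber

open LiftingNumber in
theorem corollary3p17 (p : ℕ) [Fact p.Prime] (e : ℕ) (he : 1 < e) :
    (e : ℕ∞) < LiftingNumber.liftingNumber.{u} p e ∧
    (p ∣ e → ∀ (k : Type u) [Field k] [CharP k p] [PerfectRing k p],
      ∃ E₁ E₂ : LiftingNumber.TotallyRamifiedExtension (WittVector p k) e,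
        IsEmpty (E₁.L ≃+* E₂.L) ∧
        Nonempty (LiftingNumber.ResidueRing E₁.integers e ≃ₐ[WittVector p k]
          LiftingNumber.ResidueRing E₂.integers e)) := by
  refine ⟨?_, fun hpe k _ _ _ => ?_⟩
  · obtain ⟨k, _, _, _, g, h, hg⟩ := exists_datum.{u} p e he
    -- Bounding every admissible `n` below by `e + 1` also covers an infinite lifting number.
    refine lt_of_lt_of_le (ENat.natCast_lt_natCast.mpr e.lt_succ_self) (le_sInf ?_)
    rintro _ ⟨n, hn, hL, rfl⟩
    by_contra hlt
    exact not_isLiftable h hg hn (by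
      have : n < e + 1 := by exact_mod_cast not_le.mp hlt
      omega) hL
  · have h₁ := IsRamifiedDatum.one (WittVector.irreducible (k := k) p) he
    have h₂ := IsRamifiedDatum.one_sub_X (WittVector.irreducible (k := k) p) he
    refine ⟨h₁.extension, h₂.extension, isEmpty_ringEquiv h₂ h₁
      (IsRamifiedDatum.not_exists_root_one_sub_X (WittVector.irreducible p) he hpe), ?_⟩
    have := h₁.isLocalRing
    have := h₂.isLocalRing
    exact ⟨(h₁.integersResidueEquiv e).symm.trans
      ((h₁.residueRingEquiv h₂ le_rfl).trans (h₂.integersResidueEquiv e))⟩
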